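/- Let $G$ be a finite simple $(c,d)$-regular bipartite graph: its vertex set is partitioned into two sets such that every edge joins the two sets, every vertex of the first set has degree $c$, and every vertex of the second has degree $d$. Suppose that $G$ contains a cycle, let $g$ be its girth, and assume $g+6<2g$. Let $N_{g+2}$ be the number of cycles of length $g+2$ in $G$, counted as subgraphs. A closed walk is a sequence $v_1,\dots,v_{k+1}$ of vertices with $v_jv_{j+1}\in E(G)$ for $1\le j\le k$ and $v_{k+1}=v_1$; its length is $k$, and walks with different vertex sequences are counted as different. A closed walk with cycle (CWWC) is a closed walk that is not itself a cycle and such that the subgraph formed by its edges contains a cycle. Then the number of CWWCs of length $g+6$ whose edges form a subgraph containing a cycle of length $g+2$ is equal to $$ \begin{aligned} (g+2)N_{g+2}\Big(&(g+2)(c+d-2)^2+(c+d)(c+d-1)\\ &+2\binom{\frac{g+2}{2}}{2}\big[(c-1)^2+(d-1)^2\big]+2\Big(\frac{g+2}{2}\Big)^2(c-1)(d-1)\\ &+\frac{g+2}{2}(c+d)(c+d-2)\\ &+\Big(\frac{g+2}{2}+1\Big)(c+d-2)(c+d-4)+(c-2)(2d-1)+(d-2)(2c-1)\Big). \end{aligned}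 $$ -/

import Mathlib

/-- `G` is a `(c, d)`-regular bipartite graph: its vertices are partitioned into two sets `U` and
`W` such that every edge joins `U` and `W`, every vertex of `U` has degree `c` and every vertex of
`W` has degree `d`. -/
def IsRegularBipartite {V : Type*} [Fintype V] (G : SimpleGraph V) [DecidableRel G.Adj]
    (c d : ℕ) : Prop :=
  ∃ U W : Set V, G.IsBipartiteWith U W ∧ U ∪ W = Set.univ ∧
    (∀ v ∈ U, G.degree v = c) ∧ (∀ v ∈ W, G.degree v = d)

/-- The cycles of length `j` of `G`, as subgraphs of `G` (so without base point or orientation). -/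
def cyclesOfLength {V : Type*} (G : SimpleGraph V) (j : ℕ) : Set G.Subgraph :=
  {H | ∃ (u : V) (q : G.Walk u u), q.IsCycle ∧ q.length = j ∧ q.toSubgraph = H}

/-- `N_j`, the number of cycles of length `j` of `G`. -/
noncomputable def numCycles {V : Type*} (G : SimpleGraph V) (j : ℕ) : ℕ :=
  (cyclesOfLength G j).ncard

/-- The closed walks with cycle (CWWCs) of length `n` with a cycle of length `j`: the closed walks
of length `n` that are not themselves cycles and such that the subgraph formed by their edges
contains a cycle of length `j`. As usual, a closed walk comes with its initial vertex and its
direction: two closed walks are equal if and only if their vertex sequences are. -/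
def closedWalksWithCycle {V : Type*} (G : SimpleGraph V) (n j : ℕ) :
    Set (Σ v : V, G.Walk v v) :=
  {w | w.2.length = n ∧ ¬ w.2.IsCycle ∧ ∃ H ∈ cyclesOfLength G j, H ≤ w.2.toSubgraph}

/-- The number of CWWCs of length `n` with a cycle of length `j`. -/
noncomputable def numClosedWalksWithCycle {V : Type*} (G : SimpleGraph V) (n j : ℕ) : ℕ :=
  (closedWalksWithCycle G n j).ncard

/-! Cancelling backtracks turns a closed walk into a reduced walk with the same base point and
preserves `oddEdges`, the edges traversed an odd number of times. For a closed walk these edges meet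
every vertex evenly, so a nonempty `oddEdges` contains a cycle and has at least `g` elements. If a
walk of length `g + 6` covers a cycle of length `g + 2`, the symmetric difference of that cycle with
`oddEdges` is again even and has at most `4 < g` edges, so it is empty (`oddEdges_eq_of_isCycle`).
Conversely, a nontrivial reduced closed walk shorter than `2g` is a cycle with a tail traversed out
and back (`isCycle_or_exists_eq_cons_concat`), and its odd edges are those of the cycle. Hence the
walks to be counted are exactly those with `g + 2` odd edges.

Such a walk reduces to a cycle of length `g + 2` with a tail of 0, 1 or 2 edges. Each cycle yields
`g + 2` based oriented walks from either part, and the degrees count the tails. The number of walks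
of given length with a given reduction depends only on the length of the reduction and the part
containing its end (`reductionCount_length_add_two`, `reductionCount_length_add_four`). The formula
is the sum over the two parts, which exchanges `c` and `d`. -/

namespace SimpleGraph.Walk

/-! ### Reduced closed walks and the girth -/

variable {V : Type*} {G : SimpleGraph V}

/-- A walk is reduced if it never traverses the same edge twice in a row. -/
def IsReduced {u v : V} (p : G.Walk u v) : Prop :=
  p.edges.IsChain (· ≠ ·)

theorem isReduced_nil (u : V) : (nil : G.Walk u u).IsReduced := by
  simp [IsReduced]

theorem IsReduced.of_cons {u v w : V} {h : G.Adj u v} {p : G.Walk v w}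
    (hp : (cons h p).IsReduced) : p.IsReduced := by
  rw [IsReduced, edges_cons] at hp
  exact hp.tail

theorem isReduced_cons_cons {u v w x : V} {h : G.Adj u v} {h' : G.Adj v w} {p : G.Walk w x} :
    (cons h (cons h' p)).IsReduced ↔ u ≠ w ∧ (cons h' p).IsReduced := by
  simp only [IsReduced, edges_cons, List.isChain_cons_cons, ne_eq, Sym2.eq_iff]
  have := h.ne
  have := h'.ne
  grind

theorem isReduced_cons_iff {u v w : V} {h : G.Adj u v} {p : G.Walk v w} (hp : ¬ p.Nil) :
    (cons h p).IsReduced ↔ p.snd ≠ u ∧ p.IsReduced := by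
  cases p with
  | nil => simp at hp
  | cons h' p => rw [isReduced_cons_cons, snd_cons, ne_comm]

theorem IsReduced.reverse {u v : V} {p : G.Walk u v} (hp : p.IsReduced) :
    p.reverse.IsReduced := by
  rw [IsReduced, edges_reverse, List.isChain_reverse]
  exact hp.imp fun _ _ h ↦ h.symm

theorem isReduced_reverse_iff {u v : V} {p : G.Walk u v} :
    p.reverse.IsReduced ↔ p.IsReduced :=
  ⟨fun h ↦ by simpa using h.reverse, IsReduced.reverse⟩

theorem isReduced_concat_iff {u v w : V} {p : G.Walk u v} {h : G.Adj v w} (hp : ¬ p.Nil) :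
    (p.concat h).IsReduced ↔ p.penultimate ≠ w ∧ p.IsReduced := by
  rw [← isReduced_reverse_iff, reverse_concat, isReduced_cons_iff (by simpa using hp),
    snd_reverse, isReduced_reverse_iff]

theorem IsReduced.of_append_left {u v w : V} {p : G.Walk u v} {q : G.Walk v w}
    (h : (p.append q).IsReduced) : p.IsReduced := by
  rw [IsReduced, edges_append] at h
  exact h.left_of_append

theorem IsReduced.of_append_right {u v w : V} {p : G.Walk u v} {q : G.Walk v w}
    (h : (p.append q).IsReduced) : q.IsReduced := by
  rw [IsReduced, edges_append] at h
  exact h.right_of_append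

theorem IsTrail.isReduced {u v : V} {p : G.Walk u v} (h : p.IsTrail) : p.IsReduced :=
  h.edges_nodup.isChain

/-- If the graph formed by the edges of `p` were a forest, the reduced walk `p` would be a path in
it, and a closed path is trivial. -/
theorem IsReduced.exists_isCycle {u : V} {p : G.Walk u u} (hp : p.IsReduced) (hn : ¬ p.Nil) :
    ∃ (v : V) (q : G.Walk v v), q.IsCycle ∧ q.edges ⊆ p.edges := by
  set H : SimpleGraph V := fromEdgeSet p.edgeSet with hH
  have hHG : H ≤ G := by
    intro x y h
    exact p.adj_of_mem_edges ((fromEdgeSet_adj _).1 h).1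
  have hpH : ∀ e ∈ p.edges, e ∈ H.edgeSet := by
    intro e he
    rw [edgeSet_fromEdgeSet]
    exact ⟨he, G.not_isDiag_of_mem_edgeSet (p.edges_subset_edgeSet he)⟩
  have hH' : ¬ H.IsAcyclic := by
    intro hac
    have : (p.transfer H hpH).IsPath := by
      rw [hac.isPath_iff_isChain, edges_transfer]
      exact hp
    rw [isPath_iff_nil, ← length_eq_zero_iff, length_transfer] at this
    exact hn (length_eq_zero_iff.1 this)
  simp only [IsAcyclic, not_forall, not_not] at hH'
  obtain ⟨v, q, hq⟩ := hH'
  refine ⟨v, q.mapLe hHG, hq.mapLe hHG, fun e he ↦ ?_⟩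
  rw [edges_mapLe_eq_edges] at he
  have := q.edges_subset_edgeSet he
  rw [edgeSet_fromEdgeSet] at this
  exact this.1

theorem IsReduced.le_length {u : V} {n : ℕ} {p : G.Walk u u} (hp : p.IsReduced) (hn : ¬ p.Nil)
    (hg : (n : ℕ∞) ≤ G.egirth) : n ≤ p.length := by
  obtain ⟨v, q, hq, hqp⟩ := hp.exists_isCycle hn
  have h1 := le_egirth.1 hg v q hq
  have h2 := (List.subperm_of_subset hq.edges_nodup hqp).length_le
  simp only [length_edges] at h2
  exact (Nat.cast_le.1 h1).trans h2

theorem exists_append_of_not_isPath {u v : V} (p : G.Walk u v) (hp : ¬ p.IsPath) :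
    ∃ (w : V) (p₁ : G.Walk u w) (l : G.Walk w w) (p₂ : G.Walk w v),
      ¬ l.Nil ∧ p = p₁.append (l.append p₂) := by
  classical
  induction p with
  | nil => simp at hp
  | @cons u v w h p ih =>
    by_cases hp' : p.IsPath
    · have hu : u ∈ p.support := by
        by_contra hu
        exact hp (hp'.cons hu)
      exact ⟨u, nil, cons h (p.takeUntil u hu), p.dropUntil u hu, by simp, by simp⟩
    · obtain ⟨x, p₁, l, p₂, hl, rfl⟩ := ih hp'
      exact ⟨x, cons h p₁, l, p₂, hl, by simp⟩

/-- A short closed reduced walk is a cycle, or it begins and ends with the same edge. -/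
theorem IsReduced.isCycle_or_exists_eq_cons_concat {u : V} {n : ℕ} {p : G.Walk u u}
    (hp : p.IsReduced) (hn : ¬ p.Nil) (hg : (n : ℕ∞) ≤ G.egirth) (hlen : p.length < 2 * n) :
    p.IsCycle ∨ ∃ (v : V) (h : G.Adj u v) (q : G.Walk v v), ¬ q.Nil ∧ q.IsReduced ∧
      p = cons h (q.concat h.symm) := by
  cases p with
  | nil => simp at hn
  | @cons _ v _ h r =>
    obtain ⟨w, q, h', rfl⟩ : ∃ (w : V) (q : G.Walk v w) (h' : G.Adj w u), r = q.concat h' := by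
      cases r with
      | nil => exact (h.ne rfl).elim
      | cons h₁ r => exact exists_cons_eq_concat h₁ r
    by_cases hvw : w = v
    · subst hvw
      right
      refine ⟨w, h, q, ?_, ?_, rfl⟩
      · intro hq
        rw [← eq_nil_iff_nil] at hq
        subst hq
        simp [IsReduced] at hp
      · exact (concat_eq_append q h' ▸ hp.of_cons).of_append_left
    left
    rw [isCycle_iff_isPath_tail_and_le_length]
    have h3 : n ≤ (cons h (q.concat h')).length := hp.le_length hn hg
    have hlen3 : 3 ≤ (cons h (q.concat h')).length := by
      have : q.length ≠ 0 := fun h0 ↦ hvw (eq_of_length_eq_zero h0).symm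
      simp only [length_cons, length_concat]
      omega
    suffices hpath : (q.concat h').IsPath by
      refine ⟨?_, hlen3⟩
      rw [tail_cons]
      exact (isPath_copy _ _ _).2 hpath
    by_contra hnp
    obtain ⟨x, p₁, l, p₂, hl, heq⟩ := exists_append_of_not_isPath _ hnp
    rw [heq] at hp hlen
    have hl' : n ≤ l.length := (hp.of_cons.of_append_right.of_append_left).le_length hl hg
    -- Cutting the loop `l` out of `p` and starting at the end of `l` leaves another closed walk.
    -- Its only new junction is at `u`, between the last and first edges of `p`, which differ
    -- because `w ≠ v`. Both closed walks then have length at least `n`, contradicting `p.length < 2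
    -- * n`.
    have hr : (p₂.append (cons h p₁)).IsReduced := by
      rw [IsReduced, edges_append]
      have hA : (cons h p₁).IsReduced := by
        rw [← cons_append] at hp
        exact hp.of_append_left
      have hB : p₂.IsReduced := hp.of_cons.of_append_right.of_append_right
      refine List.IsChain.append hB hA ?_
      intro a ha b hb
      have hb' : b = s(u, v) := by simpa [eq_comm] using hb
      have ha' : a = s(w, u) := by
        have h1 : (q.concat h').edges.getLast? = some s(w, u) := by simp [edges_concat]
        rw [heq, edges_append, edges_append] at h1
        have h2 : p₂.edges ≠ [] := by
          rintro h2
          simp [h2] at ha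
        rw [← List.append_assoc, List.getLast?_append_of_ne_nil _ h2, Option.mem_def.1 ha] at h1
        simpa using h1
      rw [ha', hb']
      have := h.ne
      have := h'.ne
      simp only [ne_eq, Sym2.eq_iff]
      grind
    have hr' : n ≤ (p₂.append (cons h p₁)).length :=
      hr.le_length (by simp) hg
    simp only [length_cons, length_append] at hlen hr'
    omega

/-! ### Cancellation of backtracks -/

/-- Prepend a step to a walk, cancelling it against the first step of the walk if possible. -/
def push {u v : V} (h : G.Adj u v) [DecidableEq V] : {w : V} → G.Walk v w → G.Walk u w
  | _, nil => cons h nil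
  | _, cons (v := x) h' p => if e : x = u then p.copy e rfl else cons h (cons h' p)

/-- The reduced walk obtained from a walk by cancelling all backtracks. -/
def reduce [DecidableEq V] : {u v : V} → G.Walk u v → G.Walk u v
  | _, _, nil => nil
  | _, _, cons h p => push h (reduce p)

variable [DecidableEq V]

theorem reduce_cons {u v w : V} (h : G.Adj u v) (p : G.Walk v w) :
    (cons h p).reduce = push h p.reduce :=
  rfl

theorem push_cons_symm {u v w : V} (h : G.Adj u v) (p : G.Walk u w) :
    push h (cons h.symm p) = p := by
  simp [push]

theorem push_cases {u v w : V} (h : G.Adj u v) (p : G.Walk v w) :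
    (push h p = cons h p ∧ (p.IsReduced → (cons h p).IsReduced)) ∨
      ∃ q : G.Walk u w, p = cons h.symm q ∧ push h p = q := by
  cases p with
  | nil => exact .inl ⟨rfl, fun _ ↦ by simp [IsReduced]⟩
  | @cons _ x _ h' p =>
    by_cases e : x = u
    · subst e
      exact .inr ⟨p, rfl, by simp [push]⟩
    · exact .inl ⟨by simp [push, e], fun hp ↦ isReduced_cons_cons.2 ⟨Ne.symm e, hp⟩⟩

theorem isReduced_reduce {u v : V} (p : G.Walk u v) : p.reduce.IsReduced := by
  induction p with
  | nil => exact isReduced_nil _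
  | cons h p ih =>
    obtain ⟨h1, h2⟩ | ⟨q, h1, h2⟩ := push_cases h p.reduce
    · rw [reduce, h1]
      exact h2 ih
    · rw [reduce, h2]
      exact (h1 ▸ ih).of_cons

theorem exists_length_reduce_add {u v : V} (p : G.Walk u v) :
    ∃ k, p.length = p.reduce.length + 2 * k := by
  induction p with
  | nil => exact ⟨0, rfl⟩
  | cons h p ih =>
    obtain ⟨k, hk⟩ := ih
    obtain ⟨h1, -⟩ | ⟨q, h1, h2⟩ := push_cases h p.reduce
    · exact ⟨k, by rw [reduce, h1, length_cons, length_cons, hk]; omega⟩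
    · refine ⟨k + 1, ?_⟩
      rw [h1, length_cons] at hk
      rw [reduce, h2, length_cons, hk]
      omega

theorem edges_reduce_subset {u v : V} (p : G.Walk u v) : p.reduce.edges ⊆ p.edges := by
  induction p with
  | nil => simp [reduce]
  | cons h p ih =>
    obtain ⟨h1, -⟩ | ⟨q, h1, h2⟩ := push_cases h p.reduce
    · rw [reduce, h1, edges_cons, edges_cons]
      exact List.cons_subset_cons _ ih
    · rw [reduce, h2, edges_cons]
      rw [h1, edges_cons] at ih
      exact fun e he ↦ List.mem_cons_of_mem _ (ih (List.mem_cons_of_mem _ he))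

/-- This inverts one step of `reduce` and is the source of the recursions for `reductionCount`.
Reducedness of `q` excludes `q = cons h p` when `p` starts by going back along `h`. -/
theorem push_eq_iff {u v w : V} {h : G.Adj u v} {p : G.Walk v w} {q : G.Walk u w}
    (hp : p.IsReduced) (hq : q.IsReduced) :
    push h p = q ↔ p = cons h.symm q ∨ q = cons h p := by
  constructor
  · rintro rfl
    obtain ⟨h1, -⟩ | ⟨q, h1, h2⟩ := push_cases h p
    · exact .inr h1
    · exact .inl (by rw [h2, h1])
  · rintro (rfl | rfl)
    · exact push_cons_symm h q
    · obtain ⟨h1, -⟩ | ⟨q, rfl, h2⟩ := push_cases h p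
      · exact h1
      · exact ((isReduced_cons_cons.1 hq).1 rfl).elim

end SimpleGraph.Walk

/-! ### Parity of edge traversals -/

namespace SimpleGraph

open Finset

variable {V : Type*} {G : SimpleGraph V} [DecidableEq V]

/-- A finite set of edges that is too small to contain a cycle and meets every vertex evenly is
empty. -/
theorem eq_empty_of_even_of_card_lt_egirth [Finite V] {n : ℕ} (hg : (n : ℕ∞) ≤ G.egirth)
    {F : Finset (Sym2 V)} (hFG : ∀ e ∈ F, e ∈ G.edgeSet)
    (heven : ∀ x, Even #{e ∈ F | x ∈ e}) (hF : #F < n) : F = ∅ := by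
  set H : SimpleGraph V := fromEdgeSet F with hH
  have hadj : ∀ {x y}, H.Adj x y ↔ s(x, y) ∈ F := by
    intro x y
    rw [fromEdgeSet_adj]
    exact ⟨fun h ↦ h.1, fun h ↦ ⟨h, G.ne_of_adj (hFG _ h)⟩⟩
  have hHG : H ≤ G := fun x y h ↦ hFG _ (hadj.1 h)
  have hac : H.IsAcyclic := by
    intro v q hq
    have h1 := le_egirth.1 hg v _ (hq.mapLe hHG)
    rw [Walk.mapLe, Walk.length_map, Nat.cast_le] at h1
    have h2 : q.edges.toFinset ⊆ F := by
      intro e he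
      have := q.edges_subset_edgeSet (List.mem_toFinset.1 he)
      rw [edgeSet_fromEdgeSet] at this
      exact this.1
    have h3 := card_le_card h2
    rw [List.toFinset_card_of_nodup hq.edges_nodup, Walk.length_edges] at h3
    omega
  by_contra hne
  obtain ⟨e, he⟩ := nonempty_iff_ne_empty.2 hne
  induction e with | _ a b
  have : Nonempty V := ⟨a⟩
  obtain ⟨u, v, p, hp, hmax⟩  := Walk.exists_isPath_forall_isPath_length_le_length H
  -- The end of a longest path in the forest `H` is a leaf. Evenness would give it a second edge,
  -- which would prolong the path.
  have hpos : ¬ p.Nil := by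
    rw [Walk.not_nil_iff_lt_length]
    have := hmax a b (hadj.2 he).toWalk (Walk.IsPath.of_adj (hadj.2 he))
    simp only [Adj.length_toWalk] at this
    omega
  have hpen := hadj.1 (p.adj_penultimate hpos)
  have hmem : s(p.penultimate, v) ∈ ({e ∈ F | v ∈ e} : Finset (Sym2 V)) := by simp [hpen]
  have h1 : 1 < #{e ∈ F | v ∈ e} := by
    have h0 : 0 < #{e ∈ F | v ∈ e} := card_pos.2 ⟨_, hmem⟩
    have := heven v
    grind
  obtain ⟨e', he', hne'⟩ := exists_mem_ne h1 s(p.penultimate, v)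
  rw [mem_filter] at he'
  obtain ⟨w, rfl⟩ := Sym2.mem_iff_exists.1 he'.2
  have hvw : H.Adj v w := hadj.2 he'.1
  have hw : w ∉ p.support := by
    intro hw
    have := hac.eq_penultimate_of_adj_end hp hvw hw
    subst this
    exact hne' Sym2.eq_swap
  have := hmax _ _ _ (hp.concat hw hvw)
  rw [Walk.length_concat] at this
  omega

namespace Walk

/-- The edges that a walk traverses an odd number of times. -/
def oddEdges {u v : V} (p : G.Walk u v) : Finset (Sym2 V) :=
  p.edges.toFinset.filter fun e ↦ Odd (p.edges.count e)

theorem mem_oddEdges {u v : V} {p : G.Walk u v} {e : Sym2 V} :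
    e ∈ p.oddEdges ↔ Odd (p.edges.count e) := by
  simp only [oddEdges, mem_filter, List.mem_toFinset, and_iff_right_iff_imp]
  exact fun h ↦ List.count_pos_iff.1 h.pos

theorem oddEdges_subset {u v : V} (p : G.Walk u v) : p.oddEdges ⊆ p.edges.toFinset :=
  filter_subset _ _

theorem card_oddEdges_le_length {u v : V} (p : G.Walk u v) : #p.oddEdges ≤ p.length :=
  (card_le_card p.oddEdges_subset).trans
    ((List.toFinset_card_le _).trans_eq p.length_edges)

theorem IsTrail.oddEdges {u v : V} {p : G.Walk u v} (hp : p.IsTrail) :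
    p.oddEdges = p.edges.toFinset := by
  ext e
  rw [mem_oddEdges, List.mem_toFinset, ← List.count_pos_iff]
  have := List.nodup_iff_count_le_one.1 hp.edges_nodup e
  grind

theorem IsTrail.card_oddEdges {u v : V} {p : G.Walk u v} (hp : p.IsTrail) :
    #p.oddEdges = p.length := by
  rw [hp.oddEdges, List.toFinset_card_of_nodup hp.edges_nodup, length_edges]

theorem oddEdges_cons_congr {u v w : V} (h : G.Adj u v) {p q : G.Walk v w}
    (hpq : p.oddEdges = q.oddEdges) : (cons h p).oddEdges = (cons h q).oddEdges := by
  ext e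
  have := congr(e ∈ $hpq)
  rw [mem_oddEdges, mem_oddEdges, eq_iff_iff] at this
  rw [mem_oddEdges, mem_oddEdges, edges_cons, edges_cons, List.count_cons, List.count_cons,
    Nat.odd_add, Nat.odd_add, this]

theorem oddEdges_cons_cons_symm {u v w : V} (h : G.Adj u v) (p : G.Walk u w) :
    (cons h (cons h.symm p)).oddEdges = p.oddEdges := by
  ext e
  rw [mem_oddEdges, mem_oddEdges, edges_cons, edges_cons, List.count_cons, List.count_cons,
    Sym2.eq_swap (a := v)]
  split_ifs <;> grind

theorem oddEdges_cons_concat_symm {u v : V} (h : G.Adj u v) (p : G.Walk v v) :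
    (cons h (p.concat h.symm)).oddEdges = p.oddEdges := by
  ext e
  rw [mem_oddEdges, mem_oddEdges, edges_cons, edges_concat, List.count_cons, List.concat_eq_append,
    List.count_append, List.count_singleton, Sym2.eq_swap (a := v)]
  split_ifs <;> grind

theorem oddEdges_reduce {u v : V} (p : G.Walk u v) : p.reduce.oddEdges = p.oddEdges := by
  induction p with
  | nil => rfl
  | cons h p ih =>
    rw [← oddEdges_cons_congr h ih, reduce]
    obtain ⟨h1, -⟩ | ⟨q, h1, h2⟩ := push_cases h p.reduce
    · rw [h1]
    · rw [h2, h1, oddEdges_cons_cons_symm]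

theorem even_countP_mem_edges_iff {u v : V} (p : G.Walk u v) (x : V) :
    Even (p.edges.countP (x ∈ ·)) ↔ (x = u ↔ x = v) := by
  induction p with
  | nil => simp
  | cons h p ih =>
    have := h.ne
    rw [edges_cons, List.countP_cons]
    simp only [Sym2.mem_iff, decide_eq_true_eq]
    split_ifs <;> grind

theorem even_card_filter_mem_oddEdges {u : V} (p : G.Walk u u) (x : V) :
    Even #{e ∈ p.oddEdges | x ∈ e} := by
  have h := (p.even_countP_mem_edges_iff x).2 Iff.rfl
  have h1 : p.edges.countP (x ∈ ·) = ∑ e ∈ p.edges.toFinset with x ∈ e, p.edges.count e := by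
    rw [List.countP_eq_length_filter, ← List.sum_toFinset_count_eq_length, List.toFinset_filter]
    simp only [decide_eq_true_eq]
    refine sum_congr rfl fun e he ↦ ?_
    rw [List.count_filter]
    simpa using (mem_filter.1 he).2
  rw [h1, even_sum_iff_even_card_odd, filter_filter] at h
  convert h using 2
  rw [Walk.oddEdges, filter_filter]
  simp only [and_comm]

variable {n : ℕ}

/-- Tail edges are stripped one at a time until a cycle remains; each is traversed once more in each
direction, so the parities do not change. -/
theorem IsReduced.exists_isCycle_oddEdges_eq {u : V} {p : G.Walk u u} (hp : p.IsReduced)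
    (hn : ¬ p.Nil) (hg : (n : ℕ∞) ≤ G.egirth) (hlen : p.length < 2 * n) :
    ∃ (v : V) (q : G.Walk v v), q.IsCycle ∧ q.edges ⊆ p.edges ∧
      p.oddEdges = q.edges.toFinset := by
  induction hk : p.length using Nat.strong_induction_on generalizing u p with
  | _ k ih
  subst hk
  obtain h | ⟨v, h, q, hq, hqr, rfl⟩ := hp.isCycle_or_exists_eq_cons_concat hn hg hlen
  · exact ⟨u, p, h, List.Subset.refl _, h.isTrail.oddEdges⟩
  · simp only [length_cons, length_concat] at ih hlen
    obtain ⟨w, r, hr, hrq, hodd⟩ := ih q.length (by omega) hqr hq (by omega) rfl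
    refine ⟨w, r, hr, fun e he ↦ ?_, by rw [oddEdges_cons_concat_symm, hodd]⟩
    have := hrq he
    simp [edges_concat, this]

/-- A closed walk that covers a cycle, and is too short to cover a second one, traverses exactly
the edges of the cycle an odd number of times. -/
theorem oddEdges_eq_of_isCycle [Finite V] {u v : V} {p : G.Walk u u} {q : G.Walk v v}
    (hq : q.IsCycle) (hqp : q.edges ⊆ p.edges) (hg : (n : ℕ∞) ≤ G.egirth)
    (hlen : p.length < n + q.length) : p.oddEdges = q.edges.toFinset := by
  rw [← hq.isTrail.oddEdges, ← symmDiff_eq_bot]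
  refine eq_empty_of_even_of_card_lt_egirth hg ?_ ?_ ?_
  · intro e he
    rw [mem_symmDiff] at he
    obtain ⟨he, -⟩ | ⟨he, -⟩ := he
    · exact p.edges_subset_edgeSet (List.mem_toFinset.1 (p.oddEdges_subset he))
    · exact q.edges_subset_edgeSet (List.mem_toFinset.1 (q.oddEdges_subset he))
  · intro x
    have h1 := p.even_card_filter_mem_oddEdges x
    have h2 := q.even_card_filter_mem_oddEdges x
    set A := p.oddEdges.filter (x ∈ ·) with hA
    set B := q.oddEdges.filter (x ∈ ·) with hB
    have h0 : (symmDiff p.oddEdges q.oddEdges).filter (x ∈ ·) = symmDiff A B := by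
      ext e
      simp only [hA, hB, mem_filter, mem_symmDiff]
      tauto
    rw [h0]
    have h3 := card_sdiff_add_card_inter A B
    have h4 := card_sdiff_add_card_inter B A
    have h5 : #(symmDiff A B) = #(A \ B) + #(B \ A) := by
      rw [symmDiff_def, sup_eq_union, card_union_of_disjoint disjoint_sdiff_sdiff]
    rw [inter_comm] at h4
    grind
  · have h1 : #(symmDiff p.oddEdges q.oddEdges) + #q.oddEdges ≤ p.length := by
      have hq' : q.oddEdges ⊆ p.edges.toFinset := fun e he ↦
        List.mem_toFinset.2 (hqp (List.mem_toFinset.1 (q.oddEdges_subset he)))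
      have hs : symmDiff p.oddEdges q.oddEdges ⊆ p.edges.toFinset := fun e he ↦ by
        obtain ⟨he, -⟩ | ⟨he, -⟩ := mem_symmDiff.1 he
        exacts [p.oddEdges_subset he, hq' he]
      have key : ∀ S ⊆ p.edges.toFinset, #S = ∑ e ∈ p.edges.toFinset, if e ∈ S then 1 else 0 := by
        intro S hS
        rw [← card_filter, filter_mem_eq_inter, inter_eq_right.2 hS]
      rw [key _ hs, key _ hq', ← length_edges, ← List.sum_toFinset_count_eq_length,
        ← sum_add_distrib]
      -- An edge counted in both sets lies on `q` and is traversed by `p` a positive even number of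
      -- times, hence at least twice. Any other edge is counted at most once.
      refine sum_le_sum fun e he ↦ ?_
      have hpos := List.count_pos_iff.2 (List.mem_toFinset.1 he)
      simp only [mem_symmDiff, mem_oddEdges (p := p)]
      split_ifs <;> grind
    rw [hq.isTrail.card_oddEdges] at h1
    omega

end Walk

end SimpleGraph

/-! ### Number of walks with a given reduction -/

namespace SimpleGraph

open Finset

variable {V : Type*} {G : SimpleGraph V}

theorem Walk.cons_injective {u v w : V} (h : G.Adj u v) :
    Function.Injective (Walk.cons h : G.Walk v w → G.Walk u w) := by
  intro p q hpq
  simpa using hpq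

theorem adj_of_neighborSet {u : V} (w : G.neighborSet u) : G.Adj u w :=
  (G.mem_neighborSet u w).1 w.2

variable [Fintype V] [DecidableEq V] [DecidableRel G.Adj]

theorem card_filter_finsetWalkLength_succ (n : ℕ) (u v : V) (P : G.Walk u v → Prop)
    [DecidablePred P] :
    #{p ∈ G.finsetWalkLength (n + 1) u v | P p} =
      ∑ w : G.neighborSet u, #{p ∈ G.finsetWalkLength n w v | P (.cons (adj_of_neighborSet w) p)} := by
  have key : G.finsetWalkLength (n + 1) u v = univ.biUnion fun w : G.neighborSet u ↦
      (G.finsetWalkLength n w v).map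
        ⟨Walk.cons (adj_of_neighborSet w), Walk.cons_injective _⟩ := rfl
  rw [key, filter_biUnion, card_biUnion]
  · simp_rw [filter_map, card_map]
    rfl
  · intro w₁ _ w₂ _ hne
    rw [Function.onFun]
    refine Finset.disjoint_left.2 fun p h1 h2 ↦ ?_
    simp only [mem_filter, mem_map, Function.Embedding.coeFn_mk] at h1 h2
    obtain ⟨⟨q₁, -, rfl⟩, -⟩ := h1
    obtain ⟨⟨q₂, -, h⟩, -⟩ := h2
    rw [Walk.cons.injEq] at h
    exact hne (Subtype.ext h.1.symm)

/-- The number of walks of length `n` that reduce to `r`. -/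
def reductionCount (n : ℕ) {u v : V} (r : G.Walk u v) : ℕ :=
  #{p ∈ G.finsetWalkLength n u v | p.reduce = r}

theorem reductionCount_eq_zero {n : ℕ} {u v : V} {r : G.Walk u v} (h : n < r.length) :
    reductionCount n r = 0 := by
  rw [reductionCount, card_eq_zero, filter_eq_empty_iff]
  rintro p hp rfl
  rw [mem_finsetWalkLength_iff] at hp
  obtain ⟨k, hk⟩ := p.exists_length_reduce_add
  omega

theorem reductionCount_zero_nil (v : V) : reductionCount 0 (Walk.nil : G.Walk v v) = 1 := by
  rw [reductionCount, card_eq_one]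
  refine ⟨.nil, ?_⟩
  ext p
  rw [mem_filter, mem_finsetWalkLength_iff, mem_singleton, Walk.length_eq_zero_iff,
    ← Walk.eq_nil_iff_nil]
  exact ⟨And.left, by rintro rfl; exact ⟨rfl, rfl⟩⟩

theorem reductionCount_succ_nil (n : ℕ) (v : V) :
    reductionCount (n + 1) (Walk.nil : G.Walk v v) =
      ∑ w : G.neighborSet v, reductionCount n (.cons (adj_of_neighborSet w).symm .nil : G.Walk w v) := by
  rw [reductionCount, card_filter_finsetWalkLength_succ]
  refine sum_congr rfl fun w _ ↦ ?_
  rw [reductionCount]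
  congr 1
  refine filter_congr fun p _ ↦ ?_
  rw [Walk.reduce_cons, Walk.push_eq_iff p.isReduced_reduce (Walk.isReduced_nil v)]
  simp

/-- By the first step: towards `v` it survives as the first step of the reduction; towards another
neighbour `x` it must be cancelled, so the rest reduces to a walk that returns from `x` to `u` and
follows the target. -/
theorem reductionCount_succ_cons (n : ℕ) {u v w : V} {h : G.Adj u v} {r : G.Walk v w}
    (hr : (Walk.cons h r).IsReduced) :
    reductionCount (n + 1) (.cons h r) = reductionCount n r +
      ∑ x ∈ univ.erase (⟨v, h⟩ : G.neighborSet u),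
        reductionCount n (.cons (adj_of_neighborSet x).symm (.cons h r) : G.Walk x w) := by
  rw [reductionCount, card_filter_finsetWalkLength_succ,
    ← add_sum_erase univ _ (mem_univ (⟨v, h⟩ : G.neighborSet u))]
  congr 1
  · rw [reductionCount]
    congr 1
    refine filter_congr fun p _ ↦ ?_
    rw [Walk.reduce_cons, Walk.push_eq_iff p.isReduced_reduce hr]
    constructor
    · rintro (h1 | h1)
      · have := p.isReduced_reduce
        rw [h1] at this
        exact ((Walk.isReduced_cons_cons.1 this).1 rfl).elim
      · simpa [eq_comm] using h1
    · rintro rfl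
      exact .inr rfl
  · refine sum_congr rfl fun x hx ↦ ?_
    rw [reductionCount]
    congr 1
    refine filter_congr fun p _ ↦ ?_
    rw [Walk.reduce_cons, Walk.push_eq_iff p.isReduced_reduce hr, or_iff_left]
    rw [Walk.cons.injEq]
    rintro ⟨h1, -⟩
    exact ne_of_mem_erase hx (Subtype.ext h1.symm)

theorem reductionCount_length {u v : V} {r : G.Walk u v} (hr : r.IsReduced) :
    reductionCount r.length r = 1 := by
  induction r with
  | nil => exact reductionCount_zero_nil _
  | cons h r ih =>
    rw [Walk.length_cons, reductionCount_succ_cons _ hr, ih hr.of_cons, add_eq_left]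
    refine sum_eq_zero fun x _ ↦ reductionCount_eq_zero ?_
    rw [Walk.length_cons, Walk.length_cons]
    omega

theorem isReduced_cons_of_mem_erase {u v w : V} {h : G.Adj u v} {r : G.Walk v w}
    (hr : (Walk.cons h r).IsReduced) {x : G.neighborSet u}
    (hx : x ∈ univ.erase (⟨v, h⟩ : G.neighborSet u)) :
    (Walk.cons (adj_of_neighborSet x).symm (.cons h r) : G.Walk x w).IsReduced :=
  Walk.isReduced_cons_cons.2 ⟨fun h1 ↦ ne_of_mem_erase hx (Subtype.ext h1), hr⟩

theorem cast_card_erase_neighborSet {u v : V} (h : G.Adj u v) :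
    (#(univ.erase (⟨v, h⟩ : G.neighborSet u)) : ℤ) = G.degree u - 1 := by
  rw [card_erase_of_mem (mem_univ _), card_univ, card_neighborSet_eq_degree, Nat.cast_sub,
    Nat.cast_one]
  exact (G.degree_pos_iff_exists_adj u).2 ⟨v, h⟩

/-- `c` at even numbers and `d` at odd numbers: the degrees along a walk in a biregular graph. -/
def alternatingDegree (c d : ℤ) (r : ℕ) : ℤ :=
  if Even r then c else d

/-- The number of walks of length `r + 2` that reduce to a given walk of length `r`, in a biregular
graph. -/
def oneBacktrackCount (c d : ℤ) : ℕ → ℤ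
  | 0 => c
  | r + 1 => oneBacktrackCount c d r + (alternatingDegree c d (r + 1) - 1)

/-- The number of walks of length `r + 4` that reduce to a given walk of length `r`, in a biregular
graph. -/
def twoBacktrackCount (c d : ℤ) : ℕ → ℤ
  | 0 => c * oneBacktrackCount c d 1
  | r + 1 => twoBacktrackCount c d r +
      (alternatingDegree c d (r + 1) - 1) * oneBacktrackCount c d (r + 2)

theorem oneBacktrackCount_two_mul (c d : ℤ) (k : ℕ) :
    oneBacktrackCount c d (2 * k) = c + k * (c + d - 2) := by
  induction k with
  | zero => simp [oneBacktrackCount]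
  | succ k ih =>
    rw [mul_add_one, oneBacktrackCount, oneBacktrackCount, ih, alternatingDegree,
      alternatingDegree, if_neg (by grind), if_pos (by grind)]
    push_cast
    ring

theorem oneBacktrackCount_two_mul_add_one (c d : ℤ) (k : ℕ) :
    oneBacktrackCount c d (2 * k + 1) = c + d - 1 + k * (c + d - 2) := by
  rw [oneBacktrackCount, oneBacktrackCount_two_mul, alternatingDegree, if_neg (by grind)]
  ring

theorem twoBacktrackCount_two_mul (c d : ℤ) (k : ℕ) :
    twoBacktrackCount c d (2 * k) = c * (c + d - 1) + k * (c + d - 2) ^ 2 + c * k * (c + d - 2) +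
      (k.choose 2 : ℕ) * ((c - 1) ^ 2 + (d - 1) ^ 2) + k ^ 2 * ((c - 1) * (d - 1)) := by
  induction k with
  | zero => simp [twoBacktrackCount, oneBacktrackCount_two_mul_add_one c d 0]
  | succ k ih =>
    rw [mul_add_one, twoBacktrackCount, twoBacktrackCount, ih, alternatingDegree,
      alternatingDegree, if_neg (by grind), if_pos (by grind),
      show 2 * k + 1 + 2 = 2 * (k + 1) + 1 by ring, ← mul_add_one, oneBacktrackCount_two_mul,
      oneBacktrackCount_two_mul_add_one, Nat.choose_succ_succ' k 1, Nat.choose_one_right]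
    push_cast
    ring

variable (G) in
/-- `G` is bipartite with parts `S` and `Sᶜ`, of degrees `c` and `d`. -/
structure IsBiregular (S : Finset V) (c d : ℕ) : Prop where
  mem_iff_of_adj : ∀ ⦃u v⦄, G.Adj u v → (u ∈ S ↔ v ∉ S)
  degree_of_mem : ∀ v ∈ S, G.degree v = c
  degree_of_notMem : ∀ v ∉ S, G.degree v = d

namespace IsBiregular

variable {S : Finset V} {c d : ℕ}

theorem compl (hS : G.IsBiregular S c d) : G.IsBiregular Sᶜ d c where
  mem_iff_of_adj u v h := by
    have := hS.mem_iff_of_adj h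
    simp only [mem_compl]
    tauto
  degree_of_mem v hv := hS.degree_of_notMem v (mem_compl.1 hv)
  degree_of_notMem v hv := hS.degree_of_mem v (by simpa using hv)

theorem even_length_iff (hS : G.IsBiregular S c d) {u v : V} (p : G.Walk u v) :
    Even p.length ↔ (u ∈ S ↔ v ∈ S) := by
  induction p with
  | nil => simp
  | cons h p ih =>
    have := hS.mem_iff_of_adj h
    rw [Walk.length_cons, Nat.even_add_one, ih]
    tauto

/-- Parity is measured from the end of the walk, which stays fixed in inductions on the first step.
-/
theorem degree_start (hS : G.IsBiregular S c d) {u v : V} (hv : v ∈ S) (p : G.Walk u v) :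
    (G.degree u : ℤ) = alternatingDegree c d p.length := by
  have := hS.even_length_iff p
  rw [alternatingDegree]
  split_ifs with h
  · rw [hS.degree_of_mem u (by tauto)]
  · rw [hS.degree_of_notMem u (by tauto)]

theorem reductionCount_length_add_two (hS : G.IsBiregular S c d) {u v : V} (hv : v ∈ S)
    {r : G.Walk u v} (hr : r.IsReduced) :
    (reductionCount (r.length + 2) r : ℤ) = oneBacktrackCount c d r.length := by
  induction r with
  | @nil v =>
    have h1 : ∀ w ∈ (univ : Finset (G.neighborSet v)),
        reductionCount 1 (.cons (adj_of_neighborSet w).symm .nil : G.Walk w v) = 1 :=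
      fun w _ ↦ reductionCount_length (r := .cons (adj_of_neighborSet w).symm .nil)
        (by simp [Walk.IsReduced])
    rw [Walk.length_nil, zero_add, reductionCount_succ_nil, sum_congr rfl h1,
      sum_const, card_univ, card_neighborSet_eq_degree, hS.degree_of_mem v hv]
    simp [oneBacktrackCount]
  | @cons u v w h r ih =>
    have h1 : ∀ x ∈ univ.erase (⟨v, h⟩ : G.neighborSet u),
        reductionCount (r.length + 2) (.cons (adj_of_neighborSet x).symm (.cons h r) : G.Walk x w) = 1 :=
      fun x hx ↦ reductionCount_length (isReduced_cons_of_mem_erase hr hx)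
    rw [Walk.length_cons, add_right_comm, reductionCount_succ_cons _ hr, sum_congr rfl h1,
      Nat.cast_add, ih hv hr.of_cons, oneBacktrackCount, ← Walk.length_cons h r,
      ← hS.degree_start hv, sum_const, nsmul_one, Nat.cast_id, cast_card_erase_neighborSet]

theorem reductionCount_length_add_four (hS : G.IsBiregular S c d) {u v : V} (hv : v ∈ S)
    {r : G.Walk u v} (hr : r.IsReduced) :
    (reductionCount (r.length + 4) r : ℤ) = twoBacktrackCount c d r.length := by
  induction r with
  | @nil v =>
    have h1 : ∀ w ∈ (univ : Finset (G.neighborSet v)),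
        (reductionCount 3 (.cons (adj_of_neighborSet w).symm .nil : G.Walk w v) : ℤ) = oneBacktrackCount c d 1 :=
      fun w _ ↦ hS.reductionCount_length_add_two hv
        (r := (.cons (adj_of_neighborSet w).symm .nil : G.Walk w v)) (by simp [Walk.IsReduced])
    rw [Walk.length_nil, zero_add, reductionCount_succ_nil, Nat.cast_sum, sum_congr rfl h1,
      sum_const, card_univ, card_neighborSet_eq_degree, hS.degree_of_mem v hv]
    simp [twoBacktrackCount]
  | @cons u v w h r ih =>
    have h1 : ∀ x ∈ univ.erase (⟨v, h⟩ : G.neighborSet u),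
        (reductionCount (r.length + 4) (.cons (adj_of_neighborSet x).symm (.cons h r) : G.Walk x w) : ℤ) =
          oneBacktrackCount c d (r.length + 2) :=
      fun x hx ↦ hS.reductionCount_length_add_two hv (isReduced_cons_of_mem_erase hr hx)
    rw [Walk.length_cons, add_right_comm, reductionCount_succ_cons _ hr, Nat.cast_add,
      Nat.cast_sum, sum_congr rfl h1, ih hv hr.of_cons, twoBacktrackCount, ← Walk.length_cons h r,
      ← hS.degree_start hv, sum_const, nsmul_eq_mul, cast_card_erase_neighborSet]

end IsBiregular

end SimpleGraph

/-! ### Cycles with tails -/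

namespace SimpleGraph

open Finset

variable {V : Type*} {G : SimpleGraph V}

theorem Walk.isReduced_cons_concat_symm_iff {u v : V} {h : G.Adj u v} {q : G.Walk v v}
    (hq : ¬ q.Nil) :
    (cons h (q.concat h.symm)).IsReduced ↔ q.snd ≠ u ∧ q.penultimate ≠ u ∧ q.IsReduced := by
  rw [isReduced_cons_iff (by rw [← length_eq_zero_iff, length_concat]; omega),
    isReduced_concat_iff hq]
  cases q with
  | nil => simp at hq
  | cons h' q => simp [concat_cons]

variable [DecidableEq V]

instance {u v : V} (p : G.Walk u v) : Decidable p.IsReduced :=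
  inferInstanceAs (Decidable (p.edges.IsChain (· ≠ ·)))

theorem Walk.not_nil_of_card_oddEdges_pos {u v : V} {p : G.Walk u v} (h : 0 < #p.oddEdges) :
    ¬ p.Nil := by
  have := p.card_oddEdges_le_length
  rw [not_nil_iff_lt_length]
  omega

variable [Fintype V] [DecidableRel G.Adj]

variable (G) in
/-- The reduced closed walks at `v` of length `l` that traverse exactly `n` edges an odd number of
times. -/
def reducedClosedWalks (n l : ℕ) (v : V) : Finset (G.Walk v v) :=
  {p ∈ G.finsetWalkLength l v v | p.IsReduced ∧ #p.oddEdges = n}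

theorem mem_reducedClosedWalks {n l : ℕ} {v : V} {p : G.Walk v v} :
    p ∈ G.reducedClosedWalks n l v ↔ p.length = l ∧ p.IsReduced ∧ #p.oddEdges = n := by
  rw [reducedClosedWalks, mem_filter, mem_finsetWalkLength_iff]

variable {m n l : ℕ}

/-- A tail edge would add two to the length and nothing to the odd edges, so equality of the two
numbers leaves no tail. -/
theorem mem_reducedClosedWalks_self (hg : (m : ℕ∞) ≤ G.egirth) (hn : 0 < n) (hnm : n < 2 * m)
    {v : V} {p : G.Walk v v} :
    p ∈ G.reducedClosedWalks n n v ↔ p.IsCycle ∧ p.length = n := by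
  rw [mem_reducedClosedWalks]
  constructor
  · rintro ⟨h1, h2, h3⟩
    refine ⟨?_, h1⟩
    obtain h | ⟨w, h, q, hq, -, rfl⟩ := h2.isCycle_or_exists_eq_cons_concat
      (Walk.not_nil_of_card_oddEdges_pos (by omega)) hg (by omega)
    · exact h
    · have := q.card_oddEdges_le_length
      rw [Walk.oddEdges_cons_concat_symm] at h3
      simp only [Walk.length_cons, Walk.length_concat] at h1
      omega
  · rintro ⟨h1, h2⟩
    exact ⟨h2, h1.isTrail.isReduced, by rw [h1.isTrail.card_oddEdges, h2]⟩

theorem exists_eq_cons_concat_of_mem_reducedClosedWalks (hg : (m : ℕ∞) ≤ G.egirth) (hn : 0 < n)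
    (hl : l < 2 * m) (hln : l ≠ n) {u : V} {p : G.Walk u u}
    (hp : p ∈ G.reducedClosedWalks n l u) :
    ∃ (v : V) (h : G.Adj u v) (q : G.Walk v v), ¬ q.Nil ∧ q.IsReduced ∧
      p = .cons h (q.concat h.symm) := by
  obtain ⟨h1, h2, h3⟩ := mem_reducedClosedWalks.1 hp
  obtain h | h := h2.isCycle_or_exists_eq_cons_concat
    (Walk.not_nil_of_card_oddEdges_pos (by omega)) hg (by omega)
  · rw [h.isTrail.card_oddEdges] at h3
    omega
  · exact h

theorem card_reducedClosedWalks_add_two (hg : (m : ℕ∞) ≤ G.egirth) (hn : 0 < n)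
    (hl : l + 2 < 2 * m) (hln : l + 2 ≠ n) (u : V) :
    #(G.reducedClosedWalks n (l + 2) u) = ∑ v : G.neighborSet u,
      #{q ∈ G.reducedClosedWalks n l v | q.snd ≠ u ∧ q.penultimate ≠ u} := by
  have key : G.reducedClosedWalks n (l + 2) u = univ.biUnion fun v : G.neighborSet u ↦
      {q ∈ G.reducedClosedWalks n l v | q.snd ≠ u ∧ q.penultimate ≠ u}.image
        fun q ↦ .cons (adj_of_neighborSet v) (q.concat (adj_of_neighborSet v).symm) := by
    ext p
    simp only [mem_biUnion, mem_univ, true_and, mem_image, mem_filter]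
    constructor
    · intro hp
      obtain ⟨v, h, q, hq, hqr, rfl⟩ :=
        exists_eq_cons_concat_of_mem_reducedClosedWalks hg hn hl hln hp
      obtain ⟨h1, h2, h3⟩ := mem_reducedClosedWalks.1 hp
      rw [Walk.isReduced_cons_concat_symm_iff hq] at h2
      rw [Walk.oddEdges_cons_concat_symm] at h3
      simp only [Walk.length_cons, Walk.length_concat] at h1
      exact ⟨⟨v, h⟩, q, ⟨mem_reducedClosedWalks.2 ⟨by omega, hqr, h3⟩, h2.1, h2.2.1⟩, rfl⟩
    · rintro ⟨v, q, ⟨hq, h4, h5⟩, rfl⟩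
      obtain ⟨h1, h2, h3⟩ := mem_reducedClosedWalks.1 hq
      have hnil : ¬ q.Nil := Walk.not_nil_of_card_oddEdges_pos (by omega)
      rw [mem_reducedClosedWalks, Walk.isReduced_cons_concat_symm_iff hnil,
        Walk.oddEdges_cons_concat_symm]
      simp only [Walk.length_cons, Walk.length_concat]
      exact ⟨by omega, ⟨h4, h5, h2⟩, h3⟩
  rw [key, card_biUnion]
  · refine sum_congr rfl fun v _ ↦ card_image_of_injective _ fun p q hpq ↦ ?_
    have := Walk.cons_injective _ hpq
    exact (Walk.concat_inj this).2
  · intro v₁ _ v₂ _ hne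
    rw [Function.onFun]
    refine Finset.disjoint_left.2 fun p h1 h2 ↦ ?_
    rw [mem_image] at h1 h2
    obtain ⟨q₁, -, rfl⟩ := h1
    obtain ⟨q₂, -, h⟩ := h2
    rw [Walk.cons.injEq] at h
    exact hne (Subtype.ext h.1.symm)

/-- Summing over the ends of a one-edge tail. -/
theorem IsBiregular.sum_sum_neighborSet {S : Finset V} {c d : ℕ} (hS : G.IsBiregular S c d)
    (A : (v : V) → Finset (G.Walk v v)) (P : V → (v : V) → G.Walk v v → Prop)
    [∀ u v, DecidablePred (P u v)] :
    ∑ u ∈ S, ∑ v : G.neighborSet u, #{q ∈ A v | P u v q} =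
      ∑ v ∈ Sᶜ, ∑ q ∈ A v, #{u ∈ G.neighborFinset v | P u v q} := by
  have h1 : ∀ u ∈ S, ∑ v : G.neighborSet u, #{q ∈ A v | P u v q} =
      ∑ v ∈ Sᶜ, if G.Adj u v then #{q ∈ A v | P u v q} else 0 := by
    intro u hu
    rw [← sum_filter]
    refine sum_bij (fun v _ ↦ v.1) ?_ ?_ ?_ ?_
    · intro v _
      have h := adj_of_neighborSet v
      have := hS.mem_iff_of_adj h
      simp only [mem_filter, mem_compl]
      exact ⟨by tauto, h⟩
    · exact fun v _ w _ h ↦ Subtype.ext h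
    · exact fun v hv ↦ ⟨⟨v, (mem_filter.1 hv).2⟩, mem_univ _, rfl⟩
    · exact fun _ _ ↦ rfl
  rw [sum_congr rfl h1, sum_comm]
  refine sum_congr rfl fun v hv ↦ ?_
  have h2 : {u ∈ S | G.Adj u v} = G.neighborFinset v := by
    ext u
    rw [mem_filter, mem_neighborFinset, G.adj_comm v u, and_iff_right_iff_imp]
    intro h
    have := hS.mem_iff_of_adj h
    rw [mem_compl] at hv
    tauto
  rw [← sum_filter, h2]
  simp_rw [card_filter]
  exact sum_comm

/-- The tail grows from `v` to any neighbour that creates no backtrack; `k` is the number of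
forbidden neighbours, two at a vertex of a bare cycle and one at the tip of a tail. -/
theorem IsBiregular.sum_card_reducedClosedWalks_add_two {S : Finset V} {c d k : ℕ}
    (hS : G.IsBiregular S c d) (hg : (m : ℕ∞) ≤ G.egirth) (hn : 0 < n)
    (hl : l + 2 < 2 * m) (hln : l + 2 ≠ n)
    (hk : ∀ v, ∀ q ∈ G.reducedClosedWalks n l v, #{q.snd, q.penultimate} = k) :
    ((∑ u ∈ S, #(G.reducedClosedWalks n (l + 2) u) : ℕ) : ℤ) =
      (∑ v ∈ Sᶜ, #(G.reducedClosedWalks n l v) : ℕ) * ((d : ℤ) - k) := by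
  rw [sum_congr rfl fun u _ ↦ card_reducedClosedWalks_add_two hg hn hl hln u,
    hS.sum_sum_neighborSet _ fun u _ q ↦ q.snd ≠ u ∧ q.penultimate ≠ u, Nat.cast_sum, Nat.cast_sum,
    sum_mul]
  refine sum_congr rfl fun v hv ↦ ?_
  rw [Nat.cast_sum, ← nsmul_eq_mul, ← sum_const]
  refine sum_congr rfl fun q hq ↦ ?_
  have hnil : ¬ q.Nil := Walk.not_nil_of_card_oddEdges_pos (by
    rw [(mem_reducedClosedWalks.1 hq).2.2]
    exact hn)
  have h1 : {u ∈ G.neighborFinset v | q.snd ≠ u ∧ q.penultimate ≠ u} =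
      G.neighborFinset v \ {q.snd, q.penultimate} := by
    ext u
    simp only [mem_filter, mem_sdiff, mem_insert, mem_singleton]
    grind
  have h2 : ({q.snd, q.penultimate} : Finset V) ⊆ G.neighborFinset v := by
    simp only [insert_subset_iff, singleton_subset_iff, mem_neighborFinset]
    exact ⟨q.adj_snd hnil, (q.adj_penultimate hnil).symm⟩
  rw [h1, cast_card_sdiff h2, hk v q hq, card_neighborFinset_eq_degree,
    hS.degree_of_notMem v (mem_compl.1 hv)]

theorem IsBiregular.sum_card_reducedClosedWalks_self_add_two {S : Finset V} {c d : ℕ}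
    (hS : G.IsBiregular S c d) (hg : (m : ℕ∞) ≤ G.egirth) (hn : 0 < n) (hl : n + 2 < 2 * m) :
    ((∑ u ∈ S, #(G.reducedClosedWalks n (n + 2) u) : ℕ) : ℤ) =
      (∑ v ∈ Sᶜ, #(G.reducedClosedWalks n n v) : ℕ) * ((d : ℤ) - 2) := by
  refine hS.sum_card_reducedClosedWalks_add_two (k := 2) hg hn hl (by omega) fun v q hq ↦ ?_
  rw [mem_reducedClosedWalks_self hg hn (by omega)] at hq
  exact card_pair hq.1.snd_ne_penultimate

theorem IsBiregular.sum_card_reducedClosedWalks_self_add_four {S : Finset V} {c d : ℕ}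
    (hS : G.IsBiregular S c d) (hg : (m : ℕ∞) ≤ G.egirth) (hn : 0 < n) (hl : n + 4 < 2 * m) :
    ((∑ u ∈ S, #(G.reducedClosedWalks n (n + 4) u) : ℕ) : ℤ) =
      (∑ v ∈ Sᶜ, #(G.reducedClosedWalks n (n + 2) v) : ℕ) * ((d : ℤ) - 1) := by
  refine (hS.sum_card_reducedClosedWalks_add_two (l := n + 2) (k := 1) hg hn hl (by omega)
    fun v q hq ↦ ?_).trans (by simp)
  obtain ⟨w, h, r, -, -, rfl⟩ :=
    exists_eq_cons_concat_of_mem_reducedClosedWalks hg hn (by omega) (by omega) hq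
  rw [Walk.snd_cons, Walk.penultimate_cons_of_not_nil _ _
    (by rw [← Walk.length_eq_zero_iff, Walk.length_concat]; omega), Walk.penultimate_concat]
  simp

end SimpleGraph

/-! ### From cycles as subgraphs to cycles as walks -/

namespace SimpleGraph

open Finset

variable {V : Type*} {G : SimpleGraph V}

namespace Walk

theorem IsCycle.ncard_edgeSet_toSubgraph {u : V} {p : G.Walk u u} (hp : p.IsCycle) :
    p.toSubgraph.edgeSet.ncard = p.length := by
  classical
  rw [edgeSet_toSubgraph, ← coe_edges_toFinset, Set.ncard_coe_finset,
    List.toFinset_card_of_nodup hp.edges_nodup, length_edges]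

/-- A cycle is determined by its subgraph, its first vertex and its second vertex. -/
theorem IsCycle.eq_of_toSubgraph_eq {u : V} {p q : G.Walk u u} (hp : p.IsCycle) (hq : q.IsCycle)
    (h : p.toSubgraph = q.toSubgraph) (hs : p.snd = q.snd) : p = q := by
  have hlen : p.length = q.length := by
    rw [← hp.ncard_edgeSet_toSubgraph, h, hq.ncard_edgeSet_toSubgraph]
  refine ext_getVert_le_length hlen fun k hk ↦ ?_
  induction k using Nat.twoStepInduction with
  | zero => simp
  | one => exact hs
  | more k ih₁ ih₂ =>
    have e₁ := ih₁ (by omega)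
    have e₂ := ih₂ (by omega)
    have hp' := hp.neighborSet_toSubgraph_internal (i := k + 1) (by omega) (by omega)
    have hq' := hq.neighborSet_toSubgraph_internal (i := k + 1) (by omega) (by omega)
    have np := hp.getVert_sub_one_ne_getVert_add_one (i := k + 1) (by omega)
    have nq := hq.getVert_sub_one_ne_getVert_add_one (i := k + 1) (by omega)
    rw [← e₂, ← h, hp'] at hq'
    simp only [Nat.add_sub_cancel, add_assoc, Nat.reduceAdd] at hq' np nq
    have : p.getVert (k + 2) ∈ ({q.getVert k, q.getVert (k + 2)} : Set V) := by
      rw [← hq']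
      exact .inr rfl
    obtain h1 | h1 := this
    · exact (np (e₁.trans h1.symm)).elim
    · exact h1

theorem IsCycle.exists_snd_eq {u a b : V} {p : G.Walk u u} (hp : p.IsCycle)
    (h : s(a, b) ∈ p.edges) :
    ∃ q : G.Walk a a, q.IsCycle ∧ q.toSubgraph = p.toSubgraph ∧ q.snd = b := by
  classical
  have ha : a ∈ p.support := p.fst_mem_support_of_mem_edges h
  have hq : (p.rotate a ha).IsCycle := by simpa using hp
  have hqp : (p.rotate a ha).toSubgraph = p.toSubgraph := by simp
  have hb : b ∈ (p.rotate a ha).toSubgraph.neighborSet a := by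
    rw [hqp, Subgraph.mem_neighborSet, adj_toSubgraph_iff_mem_edges]
    exact h
  rw [hq.neighborSet_toSubgraph_endpoint] at hb
  obtain hb | hb := hb
  · exact ⟨_, hq, hqp, hb.symm⟩
  · exact ⟨_, hq.reverse, by rw [toSubgraph_reverse, hqp], by rw [snd_reverse, hb]⟩

end Walk

variable [Fintype V] [DecidableEq V] [DecidableRel G.Adj]

/-- Each cycle of length `n` has exactly `n` orientations starting in a given part of the
bipartition. -/
theorem IsBiregular.sum_card_reducedClosedWalks_self {S : Finset V} {c d m n : ℕ}
    (hS : G.IsBiregular S c d) (hg : (m : ℕ∞) ≤ G.egirth) (hn : 0 < n) (hnm : n < 2 * m) :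
    ∑ v ∈ S, #(G.reducedClosedWalks n n v) = n * numCycles G n := by
  classical
  have hmem : ∀ {v : V} {p : G.Walk v v},
      p ∈ G.reducedClosedWalks n n v ↔ p.IsCycle ∧ p.length = n :=
    mem_reducedClosedWalks_self hg hn hnm
  have hfin : (cyclesOfLength G n).Finite := Set.toFinite _
  rw [← card_sigma, numCycles, Set.ncard_eq_toFinset_card _ hfin]
  have hmaps : ∀ x ∈ S.sigma (G.reducedClosedWalks n n), x.2.toSubgraph ∈ hfin.toFinset := by
    rintro ⟨v, p⟩ hp
    have hp' := hmem.1 (mem_sigma.1 hp).2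
    exact hfin.mem_toFinset.2 ⟨v, p, hp'.1, hp'.2, rfl⟩
  rw [card_eq_sum_card_fiberwise hmaps, sum_const_nat (m := n), mul_comm]
  intro H hH
  obtain ⟨u, p, hp, hpn, rfl⟩ := hfin.mem_toFinset.1 hH
  have hcard : #p.edges.toFinset = n := by
    rw [List.toFinset_card_of_nodup hp.edges_nodup, p.length_edges, hpn]
  refine Eq.trans ?_ hcard
  -- Orientations starting in `S` correspond to edges of the cycle through their first edge, since
  -- each edge has exactly one end in `S`.
  refine card_bij (fun x _ ↦ s(x.1, x.2.snd)) ?_ ?_ ?_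
  · rintro ⟨v, q⟩ hq
    simp only [mem_filter, mem_sigma, hmem] at hq
    rw [List.mem_toFinset, ← Walk.adj_toSubgraph_iff_mem_edges, ← hq.2]
    exact q.toSubgraph_adj_snd hq.1.2.1.not_nil
  · rintro ⟨v, q⟩ hq ⟨w, r⟩ hr heq
    simp only [mem_filter, mem_sigma, hmem] at hq hr
    have h1 := hS.mem_iff_of_adj (r.adj_snd hr.1.2.1.not_nil)
    obtain ⟨h2, h3⟩ | ⟨h2, -⟩ := Sym2.eq_iff.1 heq
    · simp only at h2
      subst h2
      rw [hq.1.2.1.eq_of_toSubgraph_eq hr.1.2.1 (hq.2.trans hr.2.symm) h3]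
    · simp only at h2
      rw [← h2] at h1
      tauto
  · intro e he
    rw [List.mem_toFinset] at he
    obtain ⟨a, b, ha, rfl⟩ : ∃ a b, a ∈ S ∧ e = s(a, b) := by
      induction e with | _ a b
      by_cases ha : a ∈ S
      · exact ⟨a, b, ha, rfl⟩
      · have := hS.mem_iff_of_adj (p.adj_of_mem_edges he)
        exact ⟨b, a, by tauto, Sym2.eq_swap⟩
    obtain ⟨q, hq, hqp, hqb⟩ := hp.exists_snd_eq he
    refine ⟨⟨a, q⟩, ?_, by rw [hqb]⟩
    simp only [mem_filter, mem_sigma, hmem]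
    refine ⟨⟨ha, hq, ?_⟩, hqp⟩
    rw [← hq.ncard_edgeSet_toSubgraph, hqp, hp.ncard_edgeSet_toSubgraph, hpn]

end SimpleGraph

/-! ### Assembling the count -/

namespace SimpleGraph

open Finset

variable {V : Type*} {G : SimpleGraph V} [Fintype V]

/-- The closed walks of length `g + 6` with a cycle of length `g + 2` are the closed walks that
traverse exactly `g + 2` edges an odd number of times. -/
theorem mem_closedWalksWithCycle_iff [DecidableEq V] {g : ℕ} (hg : (g : ℕ∞) ≤ G.egirth) (hlen : g + 6 < 2 * g)
    {w : Σ v : V, G.Walk v v} :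
    w ∈ closedWalksWithCycle G (g + 6) (g + 2) ↔
      w.2.length = g + 6 ∧ #w.2.oddEdges = g + 2 := by
  obtain ⟨v, p⟩ := w
  simp only [closedWalksWithCycle, Set.mem_ofPred_eq]
  refine and_congr_right fun hp ↦ ?_
  constructor
  · rintro ⟨-, H, ⟨u, q, hq, hqn, rfl⟩, hqp⟩
    rw [Walk.oddEdges_eq_of_isCycle hq ?_ hg (by omega),
      List.toFinset_card_of_nodup hq.edges_nodup, Walk.length_edges, hqn]
    intro e he
    rw [← Walk.mem_edges_toSubgraph] at he ⊢
    exact Subgraph.edgeSet_mono hqp he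
  · intro hodd
    constructor
    · intro hc
      rw [hc.isTrail.card_oddEdges] at hodd
      omega
    · rw [← p.oddEdges_reduce] at hodd
      obtain ⟨k, hk⟩ := p.exists_length_reduce_add
      obtain ⟨u, q, hq, hqp, heq⟩ := p.isReduced_reduce.exists_isCycle_oddEdges_eq
        (Walk.not_nil_of_card_oddEdges_pos (by omega)) hg (by omega)
      rw [heq, List.toFinset_card_of_nodup hq.edges_nodup, Walk.length_edges] at hodd
      refine ⟨q.toSubgraph, ⟨u, q, hq, hodd, rfl⟩, ?_⟩
      rw [Walk.toSubgraph_le_iff hq.not_nil]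
      intro e he
      rw [Walk.edgeSet_toSubgraph]
      exact p.edges_reduce_subset (hqp he)

variable [DecidableRel G.Adj]

theorem _root_.IsRegularBipartite.exists_isBiregular {c d : ℕ} (hG : IsRegularBipartite G c d) :
    ∃ S : Finset V, G.IsBiregular S c d := by
  classical
  obtain ⟨U, W, hUW, hu, hU, hW⟩ := hG
  have hmem : ∀ v, v ∉ U ↔ v ∈ W := fun v ↦
    ⟨fun h ↦ (hu.symm ▸ Set.mem_univ v : v ∈ U ∪ W).resolve_left h,
      fun h h' ↦ Set.disjoint_left.1 hUW.disjoint h' h⟩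
  refine ⟨U.toFinset, fun u v h ↦ ?_, fun v hv ↦ ?_, fun v hv ↦ ?_⟩
  · have h1 := hUW.mem_of_adj h
    rw [Set.mem_toFinset, Set.mem_toFinset]
    have := hmem u
    have := hmem v
    tauto
  · exact hU v (Set.mem_toFinset.1 hv)
  · exact hW v ((hmem v).1 fun h ↦ hv (Set.mem_toFinset.2 h))

variable [DecidableEq V]

/-- The closed walks of length `n + 4` at `v`, counted through their reductions. -/
theorem card_filter_card_oddEdges_eq (n : ℕ) (v : V) :
    #{p ∈ G.finsetWalkLength (n + 4) v v | #p.oddEdges = n} =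
      ∑ r ∈ G.reducedClosedWalks n n v, reductionCount (n + 4) r +
      (∑ r ∈ G.reducedClosedWalks n (n + 2) v, reductionCount (n + 4) r +
      ∑ r ∈ G.reducedClosedWalks n (n + 4) v, reductionCount (n + 4) r) := by
  have hdisj : ∀ {k l : ℕ}, k ≠ l →
      Disjoint (G.reducedClosedWalks n k v) (G.reducedClosedWalks n l v) := by
    intro k l hkl
    refine Finset.disjoint_left.2 fun p h1 h2 ↦ hkl ?_
    rw [mem_reducedClosedWalks] at h1 h2
    omega
  rw [← sum_union (hdisj (by omega)), ← sum_union (disjoint_union_right.2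
    ⟨hdisj (by omega), hdisj (by omega)⟩), card_eq_sum_card_fiberwise (f := Walk.reduce)
    (t := G.reducedClosedWalks n n v ∪
      (G.reducedClosedWalks n (n + 2) v ∪ G.reducedClosedWalks n (n + 4) v))]
  · refine sum_congr rfl fun r hr ↦ ?_
    have hr' : #r.oddEdges = n := by
      simp only [mem_union, mem_reducedClosedWalks] at hr
      tauto
    rw [filter_filter, reductionCount]
    congr 1
    refine filter_congr fun p _ ↦ and_iff_right_of_imp ?_
    rintro rfl
    rwa [← p.oddEdges_reduce]
  · intro p hp
    rw [mem_coe, mem_filter, mem_finsetWalkLength_iff, ← p.oddEdges_reduce] at hp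
    obtain ⟨k, hk⟩ := p.exists_length_reduce_add
    have := p.reduce.card_oddEdges_le_length
    simp only [mem_coe, mem_union, mem_reducedClosedWalks, hp.2, p.isReduced_reduce]
    -- The reduction still has `n` odd edges, so its length is at least `n` and at most two
    -- cancellations occurred.
    have : k = 0 ∨ k = 1 ∨ k = 2 := by omega
    obtain rfl | rfl | rfl := this <;> simp <;> omega

theorem IsBiregular.sum_card_filter_card_oddEdges {S : Finset V} {c d m n : ℕ}
    (hS : G.IsBiregular S c d) (hg : (m : ℕ∞) ≤ G.egirth) (hn : 0 < n) (hnm : n + 4 < 2 * m) :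
    ((∑ v ∈ S, #{p ∈ G.finsetWalkLength (n + 4) v v | #p.oddEdges = n} : ℕ) : ℤ) =
      (n * numCycles G n) * (twoBacktrackCount c d n + (d - 2) * oneBacktrackCount c d (n + 2) +
        (c - 2) * (d - 1)) := by
  have h0 : ((∑ v ∈ S, #(G.reducedClosedWalks n n v) : ℕ) : ℤ) = n * numCycles G n := by
    rw [hS.sum_card_reducedClosedWalks_self hg hn (by omega), Nat.cast_mul]
  have h0' : ((∑ v ∈ Sᶜ, #(G.reducedClosedWalks n n v) : ℕ) : ℤ) = n * numCycles G n := by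
    rw [hS.compl.sum_card_reducedClosedWalks_self hg hn (by omega), Nat.cast_mul]
  have h2 := hS.sum_card_reducedClosedWalks_self_add_two hg hn (by omega)
  have h2' := hS.compl.sum_card_reducedClosedWalks_self_add_two hg hn (by omega)
  have h4 := hS.sum_card_reducedClosedWalks_self_add_four hg hn (by omega)
  -- A two-edge tail from `S` passes through `Sᶜ` and meets the cycle in `S`, which gives the factor
  -- `(c - 2) * (d - 1)`; a one-edge tail meets it in `Sᶜ`, which gives `d - 2`.
  rw [compl_compl, h0] at h2'
  rw [h2'] at h4
  rw [h0'] at h2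
  have key : ∀ (l : ℕ) (a : ℤ),
      (∀ v ∈ S, ∀ r ∈ G.reducedClosedWalks n l v, (reductionCount (n + 4) r : ℤ) = a) →
      ((∑ v ∈ S, ∑ r ∈ G.reducedClosedWalks n l v, reductionCount (n + 4) r : ℕ) : ℤ) =
        (∑ v ∈ S, #(G.reducedClosedWalks n l v) : ℕ) * a := by
    intro l a h
    push_cast
    rw [sum_mul]
    refine sum_congr rfl fun v hv ↦ ?_
    rw [sum_congr rfl (h v hv), sum_const, nsmul_eq_mul]
  have e0 := key n (twoBacktrackCount c d n) fun v hv r hr ↦ by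
    obtain ⟨h1, h2, -⟩ := mem_reducedClosedWalks.1 hr
    rw [← h1]
    exact hS.reductionCount_length_add_four hv h2
  have e2 := key (n + 2) (oneBacktrackCount c d (n + 2)) fun v hv r hr ↦ by
    obtain ⟨h1, h2, -⟩ := mem_reducedClosedWalks.1 hr
    have := hS.reductionCount_length_add_two hv h2
    rwa [h1] at this
  have e4 := key (n + 4) 1 fun v hv r hr ↦ by
    obtain ⟨h1, h2, -⟩ := mem_reducedClosedWalks.1 hr
    have := reductionCount_length h2
    rw [h1] at this
    rw [this, Nat.cast_one]
  rw [sum_congr rfl fun v _ ↦ card_filter_card_oddEdges_eq n v, sum_add_distrib, sum_add_distrib,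
    Nat.cast_add, Nat.cast_add, e0, e2, e4, h0, h2, h4]
  ring

theorem numClosedWalksWithCycle_eq_sum {g : ℕ} (hg : (g : ℕ∞) ≤ G.egirth)
    (hlen : g + 6 < 2 * g) :
    numClosedWalksWithCycle G (g + 6) (g + 2) =
      ∑ v, #{p ∈ G.finsetWalkLength (g + 6) v v | #p.oddEdges = g + 2} := by
  rw [← card_sigma, numClosedWalksWithCycle, ← Set.ncard_coe_finset]
  congr 1
  ext w
  rw [mem_closedWalksWithCycle_iff hg hlen, mem_coe, mem_sigma, mem_filter,
    mem_finsetWalkLength_iff]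
  simp

theorem IsBiregular.even_of_egirth_eq {S : Finset V} {c d g : ℕ} (hS : G.IsBiregular S c d)
    (hg : G.egirth = g) : Even g := by
  have hac : ¬ G.IsAcyclic := by
    rw [← egirth_eq_top, hg]
    exact ENat.natCast_ne_top g
  obtain ⟨v, p, -, hp⟩ := exists_egirth_eq_length.2 hac
  rw [hg, Nat.cast_inj] at hp
  rw [hp, hS.even_length_iff]

end SimpleGraph

theorem mainTheorem7 {V : Type*} [Fintype V] (G : SimpleGraph V) [DecidableRel G.Adj]
    (c d g : ℕ) (hG : IsRegularBipartite G c d) (hg : G.egirth = (g : ℕ∞))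
    (hlen : g + 6 < 2 * g) :
    (numClosedWalksWithCycle G (g + 6) (g + 2) : ℤ) =
      ((g : ℤ) + 2) * (numCycles G (g + 2) : ℤ) *
        ((((g : ℤ) + 2) * ((c : ℤ) + d - 2) ^ 2 + ((c : ℤ) + d) * ((c : ℤ) + d - 1))
          + (2 * ((((g + 2) / 2).choose 2 : ℕ) : ℤ) * (((c : ℤ) - 1) ^ 2 + ((d : ℤ) - 1) ^ 2)
              + 2 * (((g + 2) / 2 : ℕ) : ℤ) ^ 2 * (((c : ℤ) - 1) * ((d : ℤ) - 1)))
          + (((g + 2) / 2 : ℕ) : ℤ) * (((c : ℤ) + d) * ((c : ℤ) + d - 2))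
          + (((((g + 2) / 2 : ℕ) : ℤ) + 1) * ((c : ℤ) + d - 2) * ((c : ℤ) + d - 4)
              + ((c : ℤ) - 2) * (2 * (d : ℤ) - 1) + ((d : ℤ) - 2) * (2 * (c : ℤ) - 1))) := by
  classical
  obtain ⟨S, hS⟩ := hG.exists_isBiregular
  -- The girth is even in a bipartite graph, so only the closed forms at even lengths are needed and
  -- `(g + 2) / 2` is exact.
  obtain ⟨k, hk⟩ : ∃ k, g + 2 = 2 * k := by
    obtain ⟨k, hk⟩ := hS.even_of_egirth_eq hg
    exact ⟨k + 1, by omega⟩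
  have h1 := hS.sum_card_filter_card_oddEdges (n := g + 2) hg.ge (by omega) (by omega)
  have h2 := hS.compl.sum_card_filter_card_oddEdges (n := g + 2) hg.ge (by omega) (by omega)
  rw [SimpleGraph.numClosedWalksWithCycle_eq_sum hg.ge hlen,
    ← Finset.sum_add_sum_compl S, Nat.cast_add, h1, h2]
  have hg' : (g : ℤ) + 2 = 2 * k := by exact_mod_cast hk
  rw [hk, ← mul_add_one, SimpleGraph.twoBacktrackCount_two_mul,
    SimpleGraph.twoBacktrackCount_two_mul, SimpleGraph.oneBacktrackCount_two_mul,
    SimpleGraph.oneBacktrackCount_two_mul, Nat.mul_div_cancel_left k two_pos, hg']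
  push_cast
  ring
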